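/- For $a\in\mathbb C$ and $k\in\mathbb N_0=\{0,1,2,\dots\}$ let $(a)_k=a(a+1)\cdots(a+k-1)$. For vectors $\mathbf a=(a_1,\dots,a_s)$ put $(\mathbf a)_k=\prod_j(a_j)_k$, and for $\mathbf n\in\mathbb N_0^s$ put $(\mathbf a)_{\mathbf n}=\prod_j(a_j)_{n_j}$; sums such as $\mathbf a+\mathbf n$ and $\mathbf a+1$ are taken entrywise. For a polynomial $P$ let $$F\left(\begin{matrix}\mathbf a\\\mathbf b\end{matrix}\,\vdots\,P\right)=\sum_{k\ge0}\frac{(\mathbf a)_k}{(\mathbf b)_k\,k!}P(k),$$ where $P=1$ if it is omitted, and where the series stops at $k=n$ if $-n$ is an upper parameter. Let $r,l\in\mathbb N_0$, $\mathbf f\in\mathbb C^r$, $\mathbf m\in\mathbb N_0^r$, $\mathbf h\in\mathbb C^l$, $\mathbf p\in\mathbb N_0^l$, $m=m_1+\dots+m_r$, $p=p_1+\dots+p_l$, $b,c,d,e\in\mathbb C$ and $n\in\mathbb N_0$. Suppose that $b\neq f_j$ for $j=1,\dots,r$ and $(c-b-m)_m\neq0$. Let $\boldsymbol\zeta$ be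 the vector of the zeros, with multiplicity, of the polynomial $$Q_m(t)=\frac1{(c-b-m)_m}\sum_{k=0}^m\frac{(-1)^k}{k!}F\left(\begin{matrix}-k,\mathbf f+\mathbf m\\\mathbf f\end{matrix}\right)(b)_k(t)_k(c-b-m-t)_{m-k},$$ and let $$Y_p(t)=\frac{(\mathbf h-d)_{\mathbf p}}{\Gamma(e-d)}\sum_{j=0}^p\frac{(d-e+1)_j}{j!}F\left(\begin{matrix}-j,1-\mathbf h+d\\1-\mathbf h+d-\mathbf p\end{matrix}\right)(t+d)_j(t+d-e-n+j+1)_{p-j}.$$ Assume that $c$, $e$, the $f_j$, the $h_i$ and $e-d$ are not non-positive integers, and that no denominator vanishes, i.e. $(1+d-e-n)_p\neq0$, $(1+d-e-n+p)_n\neq0$, $(\boldsymbol\zeta)_n\neq0$ and $(1-h_i+d-p_i)_p\neq0$ for $i=1,\dots,l$. Then $$F\left(\begin{matrix}-n,b,d,\mathbf f+\mathbf m,\mathbf h+\mathbf p\\c,e,\mathbf f,\mathbf h\end{matrix}\right)=\frac{(e-d)_n\,\Gamma(e-d)}{(e)_n(1+d-e-n)_p(\mathbf h)_{\mathbf p}}\,F\left(\begin{matrix}-n,c-b-m,d,\boldsymbol\zeta+1\\c,1+d-e-n+p,\boldsymbol\zeta\end{matrix}\,\vdots\,Y_p\right).$$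 (For $r=0$, so $m=0$, the parameters $\mathbf f+\mathbf m,\mathbf f,\boldsymbol\zeta+1,\boldsymbol\zeta$ are absent.) -/

import Mathlib

open Polynomial

noncomputable section

/-- The Pochhammer symbol `(a)_k = a (a + 1) ⋯ (a + k - 1)` of a complex number. -/
def poch (a : ℂ) (k : ℕ) : ℂ := (ascPochhammer ℂ k).eval a

/-- For a vector `A` of parameters (with repetitions), the product `(A)_k = ∏ (a)_k` over the
entries `a` of `A`. -/
def pochVec (A : Multiset ℂ) (k : ℕ) : ℂ := (A.map fun a => poch a k).prod

/-- For vectors `a` and `n` of the same length, the product `(a)_n = ∏ j, (a_j)_{n_j}`. -/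
def pochMulti {r : ℕ} (a : Fin r → ℂ) (n : Fin r → ℕ) : ℂ := ∏ j, poch (a j) (n j)

/-- The list of entries of a complex vector, as a parameter vector. -/
def entries {r : ℕ} (a : Fin r → ℂ) : Multiset ℂ := Finset.univ.val.map a

/-- The extended generalized hypergeometric function with upper parameters `A`, lower
parameters `B` and a polynomial `P` inserted in the summand:
`F(A; B ⋮ P | x) = ∑ₖ (A)_k / ((B)_k k!) P(k) x^k`.
If an upper parameter equals `-n`, all terms with `k > n` have a vanishing numerator and are `0`,
so that the series is the finite sum over `k ≤ n`. -/
def hypF (A B : Multiset ℂ) (P : ℂ[X]) (x : ℂ) : ℂ :=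
  ∑' k : ℕ, pochVec A k / (pochVec B k * (k.factorial : ℂ)) * P.eval (k : ℂ) * x ^ k

/-- The first Miller-Paris characteristic polynomial `Q_m(b, c, f, m; t)`, where
`m = m_1 + ⋯ + m_r`:
`1 / (c-b-m)_m ∑_{k=0}^m (-1)^k / k! F(-k, f+m; f) (b)_k (t)_k (c-b-m-t)_{m-k}`. -/
def millerParisQ {r : ℕ} (b c : ℂ) (f : Fin r → ℂ) (m : Fin r → ℕ) : ℂ[X] :=
  C (1 / poch (c - b - ((∑ j, m j : ℕ) : ℂ)) (∑ j, m j)) *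
    ∑ k ∈ Finset.range ((∑ j, m j) + 1),
      C ((-1) ^ k / (k.factorial : ℂ) *
          hypF (-(k : ℂ) ::ₘ entries fun j => f j + (m j : ℂ)) (entries f) 1 1 * poch b k) *
        ascPochhammer ℂ k *
        (ascPochhammer ℂ ((∑ j, m j) - k)).comp (C (c - b - ((∑ j, m j : ℕ) : ℂ)) - X)

/-- The polynomial `Y_p(u, v; t)` with parameters `d, e, λ, h, p`, where `p = p_1 + ⋯ + p_l`:
`(h-d)_p / Γ(e-d) ∑_{j=0}^p (d-e+1)_j / j! F(-j, 1-h+d; 1-h+d-p) (ut+d)_j (vt+d-e-λ+j+1)_{p-j}`,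
the parameter `λ` being called `lam`. -/
def polyY {l : ℕ} (d e lam : ℂ) (h : Fin l → ℂ) (p : Fin l → ℕ) (u v : ℤ) : ℂ[X] :=
  C (pochMulti (fun j => h j - d) p / Complex.Gamma (e - d)) *
    ∑ j ∈ Finset.range ((∑ i, p i) + 1),
      C (poch (d - e + 1) j / (j.factorial : ℂ) *
          hypF (-(j : ℂ) ::ₘ entries fun i => 1 - h i + d)
            (entries fun i => 1 - h i + d - (p i : ℂ)) 1 1) *
        (ascPochhammer ℂ j).comp (C (u : ℂ) * X + C d) *
        (ascPochhammer ℂ ((∑ i, p i) - j)).comp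
          (C (v : ℂ) * X + C (d - e - lam + (j : ℂ) + 1))

end

/-! ### Pochhammer symbols -/

/-! Everything is a finite rearrangement resting on Newton expansion and Chu-Vandermonde. In the
`k`-th term on the left, the parameters `f` and `h` contribute polynomials `(f+k)_m` and `(h+k)_p`,
up to constants (`pochVec_div_pochVec`). The factor `(b)_k (f+k)_m / (c)_k` is expanded in `(-k)_i /
i!`; its coefficients are values at `-i` of the Miller-Paris polynomial, times `(c-b-m)_i / (c)_i`
(`poch_div_mul_shiftPoch`). After interchanging the sums, the inner sum over `k` is evaluated by
expanding `(h+k)_p` in `(k+d)_j`, which produces `Y_p(i)` (`sum_poch_neg_mul_shiftPoch_eq_polyY`).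
Finally `Q(-i)` equals `(ζ+1)_i / (ζ)_i` because `Q(0) = 1` (`pochVec_roots_div`). -/

@[simp] lemma poch_zero (a : ℂ) : poch a 0 = 1 := by simp [poch]

lemma poch_succ (a : ℂ) (k : ℕ) : poch a (k + 1) = poch a k * (a + k) :=
  ascPochhammer_succ_eval k a

lemma poch_add (a : ℂ) (j k : ℕ) : poch a (j + k) = poch a j * poch (a + j) k := by
  simp [poch, ← ascPochhammer_mul ℂ j k]

lemma poch_succ_left (a : ℂ) (k : ℕ) : poch a (k + 1) = a * poch (a + 1) k := by
  rw [add_comm k 1, poch_add, poch_succ]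
  simp

lemma poch_comm (a : ℂ) (j k : ℕ) :
    poch a j * poch (a + j) k = poch a k * poch (a + k) j := by
  rw [← poch_add, ← poch_add, add_comm]

lemma poch_ne_zero_of_le {a : ℂ} {j k : ℕ} (h : poch a k ≠ 0) (hjk : j ≤ k) : poch a j ≠ 0 := by
  obtain ⟨i, rfl⟩ := Nat.exists_eq_add_of_le hjk
  rw [poch_add] at h
  exact left_ne_zero_of_mul h

lemma poch_ne_zero {a : ℂ} (h : ∀ k : ℕ, a ≠ -(k : ℂ)) (k : ℕ) : poch a k ≠ 0 := by
  induction k with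
  | zero => simp
  | succ k ih =>
    rw [poch_succ]
    exact mul_ne_zero ih fun h0 => h k (eq_neg_of_add_eq_zero_left h0)

lemma poch_neg_natCast (N k : ℕ) :
    poch (-(N : ℂ)) k = (-1) ^ k * ((k.factorial : ℂ) * (N.choose k : ℂ)) := by
  rw [poch, ascPochhammer_eval_neg_eq_descPochhammer, descPochhammer_eval_eq_descFactorial,
    Nat.descFactorial_eq_factorial_mul_choose, Nat.cast_mul]

lemma poch_neg_natCast_div (N k : ℕ) :
    poch (-(N : ℂ)) k / (k.factorial : ℂ) = (-1) ^ k * (N.choose k : ℂ) := by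
  have : (k.factorial : ℂ) ≠ 0 := by exact_mod_cast k.factorial_ne_zero
  rw [poch_neg_natCast]
  field_simp

lemma poch_neg_natCast_eq_zero {N k : ℕ} (h : N < k) : poch (-(N : ℂ)) k = 0 := by
  simp [poch_neg_natCast, Nat.choose_eq_zero_of_lt h]

lemma poch_reflect (a : ℂ) (k : ℕ) : poch (1 - a - k) k = (-1) ^ k * poch a k := by
  induction k generalizing a with
  | zero => simp
  | succ k ih =>
    have := ih (a + 1)
    rw [poch_succ_left a, poch_succ,
      show 1 - a - ((k + 1 : ℕ) : ℂ) = 1 - (a + 1) - k - (0 : ℂ) by push_cast; ring, sub_zero, this]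
    ring

/-- Up to the sign `(-1)^s`, both sides split `(y-s)_{s+q}`, after `q` or after `s` factors. -/
lemma poch_sub_mul (y : ℂ) (s q : ℕ) :
    poch (y - s) q * poch (1 - y - q) s = poch y q * poch (1 - y) s := by
  have h1 := poch_reflect (y + q - s) s
  have h2 := poch_reflect (y - s) s
  have h3 := poch_comm (y - s) q s
  rw [show 1 - (y + q - s) - s = 1 - y - q by ring] at h1
  rw [show 1 - (y - s) - s = 1 - y by ring] at h2
  rw [show y - s + q = y + q - s by ring, sub_add_cancel] at h3
  rw [h1, h2]
  linear_combination (-1) ^ s * h3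

/-! ### Newton's formula -/

/-- Binomial inversion: the inner sum is `(-1)^i` times the `i`-th forward difference of `a` at `0`.
The outer bound may be any `K ≥ k`, since `(-k)_i = 0` for `i > k`. -/
lemma sum_newton (a : ℕ → ℂ) {k K : ℕ} (hk : k ≤ K) :
    a k = ∑ i ∈ Finset.range (K + 1), poch (-(k : ℂ)) i / (i.factorial : ℂ) *
      ∑ s ∈ Finset.range (i + 1), poch (-(i : ℂ)) s / (s.factorial : ℂ) * a s := by
  have h1 := shift_eq_sum_fwdDiff_iter 1 a k 0
  simp only [smul_eq_mul, mul_one, zero_add] at h1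
  rw [h1]
  apply Finset.sum_subset_zero_on_sdiff
  · intro x hx
    simp only [Finset.mem_range] at hx ⊢
    lia
  · intro x hx
    simp only [Finset.mem_sdiff, Finset.mem_range] at hx
    rw [poch_neg_natCast_eq_zero (by lia)]
    simp
  · intro i _
    rw [fwdDiff_iter_eq_sum_shift, poch_neg_natCast_div, nsmul_eq_mul, mul_comm ((-1) ^ i : ℂ),
      mul_assoc]
    congr 1
    rw [Finset.mul_sum]
    apply Finset.sum_congr rfl
    intro s hs
    obtain ⟨t, rfl⟩ := Nat.exists_eq_add_of_le (Nat.lt_succ_iff.mp (Finset.mem_range.mp hs))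
    rw [poch_neg_natCast_div]
    simp only [zsmul_eq_mul, Nat.add_sub_cancel_left, zero_add, smul_eq_mul, mul_one]
    push_cast
    have : ((-1) ^ s * (-1) ^ s : ℂ) = 1 := by rw [← mul_pow]; simp
    rw [pow_add]
    linear_combination -((-1 : ℂ) ^ t * ((s + t).choose s : ℂ) * a s) * this

/-- Newton interpolation at `0, -1, …, -K`: both sides have degree at most `K` and agree at these `K
+ 1` nodes by `sum_newton`. -/
lemma Polynomial.eval_eq_sum_newton (P : ℂ[X]) {K : ℕ} (hP : P.natDegree ≤ K) (x : ℂ) :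
    P.eval x = ∑ i ∈ Finset.range (K + 1), poch x i / (i.factorial : ℂ) *
      ∑ s ∈ Finset.range (i + 1), poch (-(i : ℂ)) s / (s.factorial : ℂ) * P.eval (-(s : ℂ)) := by
  set g : ℕ → ℂ := fun i =>
    ∑ s ∈ Finset.range (i + 1), poch (-(i : ℂ)) s / (s.factorial : ℂ) * P.eval (-(s : ℂ)) with hg
  set R : ℂ[X] := ∑ i ∈ Finset.range (K + 1), C (g i / (i.factorial : ℂ)) * ascPochhammer ℂ i
  have hR : ∀ y, R.eval y = ∑ i ∈ Finset.range (K + 1), poch y i / (i.factorial : ℂ) * g i := by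
    intro y
    simp only [R, eval_finsetSum, eval_mul, eval_C, poch]
    exact Finset.sum_congr rfl fun i _ => by ring
  have hRdeg : R.natDegree ≤ K := by
    apply natDegree_sum_le_of_forall_le
    intro i hi
    refine (natDegree_C_mul_le _ _).trans ?_
    rw [ascPochhammer_natDegree]
    exact Nat.lt_succ_iff.mp (Finset.mem_range.mp hi)
  have hinj : Function.Injective fun k : ℕ => -(k : ℂ) := neg_injective.comp Nat.cast_injective
  have hcard : ((Finset.range (K + 1)).image fun k : ℕ => -(k : ℂ)).card = K + 1 := by
    rw [Finset.card_image_of_injective _ hinj, Finset.card_range]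
  have hlt : ∀ S : ℂ[X], S.natDegree ≤ K →
      S.degree < (((Finset.range (K + 1)).image fun k : ℕ => -(k : ℂ)).card : WithBot ℕ) := by
    intro S hS
    rw [hcard]
    exact (degree_le_of_natDegree_le hS).trans_lt (by exact_mod_cast Nat.lt_succ_self K)
  have : P = R := by
    apply eq_of_degrees_lt_of_eval_finset_eq _ (hlt P hP) (hlt R hRdeg)
    intro y hy
    obtain ⟨k, hk, rfl⟩ := Finset.mem_image.mp hy
    rw [hR]
    exact sum_newton (fun s => P.eval (-(s : ℂ))) (Nat.lt_succ_iff.mp (Finset.mem_range.mp hk))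
  rw [← hR, ← this]

/-! ### The Chu-Vandermonde sum -/

lemma chu_vandermonde (N : ℕ) (a e : ℂ) (he : poch e N ≠ 0) :
    ∑ k ∈ Finset.range (N + 1), (-1) ^ k * (N.choose k : ℂ) * (poch a k / poch e k) =
      poch (e - a) N / poch e N := by
  induction N generalizing a e with
  | zero => simp
  | succ N ih =>
    have he0 : poch e N ≠ 0 := poch_ne_zero_of_le he N.le_succ
    have h1 : e ≠ 0 ∧ poch (e + 1) N ≠ 0 := by
      rwa [poch_succ_left, mul_ne_zero_iff] at he
    have h2 : e + N ≠ 0 := by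
      rw [poch_succ] at he
      exact right_ne_zero_of_mul he
    -- Pascal's rule; the shifted half is again a sum of length `N`, with `a` and `e` raised by one.
    have key : ∑ k ∈ Finset.range (N + 1 + 1),
          (-1) ^ k * ((N + 1).choose k : ℂ) * (poch a k / poch e k) =
        ∑ k ∈ Finset.range (N + 1), (-1) ^ k * (N.choose k : ℂ) * (poch a k / poch e k) -
        a / e * ∑ k ∈ Finset.range (N + 1),
          (-1) ^ k * (N.choose k : ℂ) * (poch (a + 1) k / poch (e + 1) k) := by
      rw [Finset.sum_range_succ', Finset.mul_sum]
      have : ∑ k ∈ Finset.range (N + 1), (-1) ^ k * (N.choose k : ℂ) * (poch a k / poch e k) =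
          ∑ k ∈ Finset.range (N + 1), (-1) ^ (k + 1) * (N.choose (k + 1) : ℂ) *
            (poch a (k + 1) / poch e (k + 1)) + 1 := by
        have h := Finset.sum_range_succ' (fun k : ℕ =>
          (-1) ^ k * (N.choose k : ℂ) * (poch a k / poch e k)) (N + 1)
        rw [Finset.sum_range_succ] at h
        simpa using h
      rw [this, add_sub_right_comm, ← Finset.sum_sub_distrib]
      simp only [pow_zero, Nat.choose_zero_right, Nat.cast_one, poch_zero, div_one, mul_one]
      congr 1
      apply Finset.sum_congr rfl
      intro k _
      rw [Nat.choose_succ_succ, poch_succ_left a, poch_succ_left e, mul_div_mul_comm]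
      push_cast
      ring
    have h3 := poch_succ e N
    rw [poch_succ_left] at h3
    have h4 : poch (e + 1) N = poch e N * (e + N) / e := by
      rw [← h3]; field_simp [h1.1]
    rw [key, ih a e he0, ih (a + 1) (e + 1) h1.2, add_sub_add_right_eq_sub, h4, poch_succ,
      poch_succ]
    have := h1.1
    field_simp
    ring

/-- The factor `(-k)_i` kills the terms with `k < i`; shifting `k` by `i` leaves Chu-Vandermonde of
length `N - i` at `a + i`, `e + i`. -/
lemma sum_poch_neg_mul_poch_div (N i : ℕ) (hi : i ≤ N) (a e : ℂ) (he : poch e N ≠ 0) :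
    ∑ k ∈ Finset.range (N + 1), poch (-(N : ℂ)) k / (k.factorial : ℂ) *
        (poch a k / poch e k) * poch (-(k : ℂ)) i =
      (-1) ^ i * poch (-(N : ℂ)) i * poch a i * poch (e - a) (N - i) / poch e N := by
  obtain ⟨N, rfl⟩ := Nat.exists_eq_add_of_le hi
  rw [add_assoc, Finset.sum_range_add, Finset.sum_eq_zero, zero_add, Nat.add_sub_cancel_left]
  · rw [poch_add] at he
    have h := chu_vandermonde N (a + i) (e + i) (right_ne_zero_of_mul he)
    rw [add_sub_add_right_eq_sub] at h
    rw [poch_add e, mul_div_mul_comm, ← h, Finset.mul_sum]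
    apply Finset.sum_congr rfl
    intro k _
    have hc : ((i + N).choose (i + k) : ℂ) * ((i + k).choose i : ℂ) =
        ((i + N).choose i : ℂ) * (N.choose k : ℂ) := by
      have := Nat.choose_mul (n := i + N) (k := i + k) (s := i) (by lia)
      simp only [Nat.add_sub_cancel_left] at this
      exact_mod_cast this
    rw [poch_neg_natCast_div, poch_add a, poch_add e, poch_neg_natCast, poch_neg_natCast, pow_add,
      mul_div_mul_comm]
    linear_combination ((-1) ^ i * (-1) ^ k * (-1) ^ i * (i.factorial : ℂ) * (poch a i / poch e i) *
      (poch (a + i) k / poch (e + i) k)) * hc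
  · intro k hk
    rw [poch_neg_natCast_eq_zero (Finset.mem_range.mp hk), mul_zero]

/-! ### Parameter vectors and terminating series -/

lemma pochVec_cons (a : ℂ) (A : Multiset ℂ) (k : ℕ) :
    pochVec (a ::ₘ A) k = poch a k * pochVec A k := by simp [pochVec]

lemma pochVec_pair (a b : ℂ) (k : ℕ) : pochVec {a, b} k = poch a k * poch b k := by
  simp [pochVec]

lemma pochVec_add (A B : Multiset ℂ) (k : ℕ) : pochVec (A + B) k = pochVec A k * pochVec B k := by
  simp [pochVec]

lemma pochVec_entries {r : ℕ} (a : Fin r → ℂ) (k : ℕ) :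
    pochVec (entries a) k = ∏ j, poch (a j) k := by
  rw [pochVec, entries, Multiset.map_map]
  rfl

lemma hypF_neg_natCast_cons (N : ℕ) (A B : Multiset ℂ) (P : ℂ[X]) :
    hypF (-(N : ℂ) ::ₘ A) B P 1 = ∑ k ∈ Finset.range (N + 1),
      poch (-(N : ℂ)) k / (k.factorial : ℂ) * (pochVec A k / pochVec B k) * P.eval (k : ℂ) := by
  rw [hypF, tsum_eq_sum (s := Finset.range (N + 1))]
  · apply Finset.sum_congr rfl
    intro k _
    rw [pochVec_cons, one_pow, mul_one, mul_comm (pochVec B k), mul_div_mul_comm]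
  · intro k hk
    rw [pochVec_cons, poch_neg_natCast_eq_zero (by simpa using hk)]
    simp

/-- The polynomial `(f + t)_m`, a product over the entries of `f` and `m`. -/
noncomputable def shiftPoch {r : ℕ} (f : Fin r → ℂ) (m : Fin r → ℕ) : ℂ[X] :=
  ∏ j, (ascPochhammer ℂ (m j)).comp (X + C (f j))

lemma eval_shiftPoch {r : ℕ} (f : Fin r → ℂ) (m : Fin r → ℕ) (t : ℂ) :
    (shiftPoch f m).eval t = ∏ j, poch (f j + t) (m j) := by
  simp [shiftPoch, eval_prod, poch, add_comm]

lemma natDegree_shiftPoch_le {r : ℕ} (f : Fin r → ℂ) (m : Fin r → ℕ) :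
    (shiftPoch f m).natDegree ≤ ∑ j, m j := by
  refine (natDegree_prod_le _ _).trans (Finset.sum_le_sum fun j _ => ?_)
  refine natDegree_comp_le.trans ?_
  rw [ascPochhammer_natDegree, natDegree_X_add_C, mul_one]

lemma pochVec_div_pochVec {r : ℕ} (f : Fin r → ℂ) (m : Fin r → ℕ)
    (hf : ∀ (j : Fin r) (k : ℕ), f j ≠ -(k : ℂ)) (k : ℕ) :
    pochVec (entries fun j => f j + (m j : ℂ)) k / pochVec (entries f) k =
      (shiftPoch f m).eval (k : ℂ) / pochMulti f m := by
  rw [pochVec_entries, pochVec_entries, eval_shiftPoch, pochMulti, ← Finset.prod_div_distrib,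
    ← Finset.prod_div_distrib]
  refine Finset.prod_congr rfl fun j _ => ?_
  rw [div_eq_div_iff (poch_ne_zero (hf j) k) (poch_ne_zero (hf j) (m j))]
  linear_combination poch_comm (f j) (m j) k

/-- With `y = h - d`, this identifies the series inside `Y_p` as Newton coefficients of `(y+t)_p`.
-/
lemma pochMulti_mul_pochVec_div {l : ℕ} (y : Fin l → ℂ) (p : Fin l → ℕ) (s : ℕ)
    (hY : ∀ i, poch (1 - y i - (p i : ℂ)) s ≠ 0) :
    pochMulti y p * (pochVec (entries fun i => 1 - y i) s /
      pochVec (entries fun i => 1 - y i - (p i : ℂ)) s) = (shiftPoch y p).eval (-(s : ℂ)) := by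
  rw [pochVec_entries, pochVec_entries, eval_shiftPoch, pochMulti, ← Finset.prod_div_distrib,
    ← Finset.prod_mul_distrib]
  refine Finset.prod_congr rfl fun i _ => ?_
  have h := poch_sub_mul (y i) s (p i)
  rw [← sub_eq_add_neg, mul_div_assoc', ← h, mul_div_cancel_right₀ _ (hY i)]

/-! ### The Miller-Paris polynomial -/

section MillerParis

variable {r : ℕ} (f : Fin r → ℂ) (m : Fin r → ℕ)

lemma hypF_shift (hf : ∀ (j : Fin r) (k : ℕ), f j ≠ -(k : ℂ)) (q : ℕ) :
    hypF (-(q : ℂ) ::ₘ entries fun j => f j + (m j : ℂ)) (entries f) 1 1 =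
      ∑ s ∈ Finset.range (q + 1), poch (-(q : ℂ)) s / (s.factorial : ℂ) *
        ((shiftPoch f m).eval (s : ℂ) / pochMulti f m) := by
  rw [hypF_neg_natCast_cons]
  simp only [eval_one, mul_one, pochVec_div_pochVec f m hf]

lemma eval_shiftPoch_div_eq_sum (hf : ∀ (j : Fin r) (k : ℕ), f j ≠ -(k : ℂ)) (k : ℕ) :
    (shiftPoch f m).eval (k : ℂ) / pochMulti f m =
      ∑ q ∈ Finset.range ((∑ j, m j) + 1), poch (-(k : ℂ)) q / (q.factorial : ℂ) *
        hypF (-(q : ℂ) ::ₘ entries fun j => f j + (m j : ℂ)) (entries f) 1 1 := by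
  -- The reflection `t ↦ -t` moves the interpolation nodes to the natural numbers, where the series
  -- `F(-q, f+m; f)` samples the polynomial.
  have hdeg : (C (pochMulti f m)⁻¹ * (shiftPoch f m).comp (-X)).natDegree ≤ ∑ j, m j := by
    refine (natDegree_C_mul_le _ _).trans (natDegree_comp_le.trans ?_)
    rw [natDegree_neg, natDegree_X, mul_one]
    exact natDegree_shiftPoch_le f m
  have h := eval_eq_sum_newton _ hdeg (-(k : ℂ))
  simp only [eval_mul, eval_C, eval_comp, eval_neg, eval_X, neg_neg] at h
  simp only [hypF_shift f m hf, div_eq_inv_mul _ (pochMulti f m)]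
  exact h

lemma eval_millerParisQ (b c t : ℂ) :
    (millerParisQ b c f m).eval t =
      1 / poch (c - b - ((∑ j, m j : ℕ) : ℂ)) (∑ j, m j) *
      ∑ k ∈ Finset.range ((∑ j, m j) + 1), (-1) ^ k / (k.factorial : ℂ) *
        hypF (-(k : ℂ) ::ₘ entries fun j => f j + (m j : ℂ)) (entries f) 1 1 * poch b k *
        poch t k * poch (c - b - ((∑ j, m j : ℕ) : ℂ) - t) ((∑ j, m j) - k) := by
  simp only [millerParisQ, eval_mul, eval_C, eval_finsetSum, eval_comp, eval_sub, eval_X, poch]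

lemma eval_zero_millerParisQ (b c : ℂ)
    (hcb : poch (c - b - ((∑ j, m j : ℕ) : ℂ)) (∑ j, m j) ≠ 0) :
    (millerParisQ b c f m).eval 0 = 1 := by
  rw [eval_millerParisQ, Finset.sum_eq_single (0 : ℕ)]
  · rw [hypF, tsum_eq_single 0]
    · simpa [pochVec] using inv_mul_cancel₀ hcb
    · intro k hk
      have := poch_neg_natCast_eq_zero (Nat.pos_of_ne_zero hk)
      rw [pochVec_cons, this]
      simp
  · intro k _ hk
    have := poch_neg_natCast_eq_zero (Nat.pos_of_ne_zero hk)
    rw [Nat.cast_zero, neg_zero] at this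
    simp [this]
  · simp

/-- For `q ≤ i`, `(c-b-m)_{m+i-q}` is split at `i` and at `m`, which cancels the normalising
`(c-b-m)_m`. For `q > i`, `(-i)_q = 0`, so the truncated `i - q` is harmless. -/
lemma poch_mul_eval_millerParisQ (b c : ℂ)
    (hcb : poch (c - b - ((∑ j, m j : ℕ) : ℂ)) (∑ j, m j) ≠ 0) (i : ℕ) :
    poch (c - b - ((∑ j, m j : ℕ) : ℂ)) i * (millerParisQ b c f m).eval (-(i : ℂ)) =
      ∑ q ∈ Finset.range ((∑ j, m j) + 1), (-1) ^ q / (q.factorial : ℂ) *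
        hypF (-(q : ℂ) ::ₘ entries fun j => f j + (m j : ℂ)) (entries f) 1 1 * poch b q *
        poch (-(i : ℂ)) q * poch (c - b) (i - q) := by
  rw [eval_millerParisQ, Finset.mul_sum, Finset.mul_sum]
  apply Finset.sum_congr rfl
  intro q hq
  set M := ∑ j, m j
  rcases lt_or_ge i q with hiq | hqi
  · simp [poch_neg_natCast_eq_zero hiq]
  · have hqM : q ≤ M := Nat.lt_succ_iff.mp (Finset.mem_range.mp hq)
    have h1 := poch_add (c - b - (M : ℂ)) i (M - q)
    have h2 := poch_add (c - b - (M : ℂ)) M (i - q)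
    rw [show i + (M - q) = M + (i - q) by lia, h2, sub_add_cancel] at h1
    rw [sub_neg_eq_add]
    set K := (-1) ^ q / (q.factorial : ℂ) *
      hypF (-(q : ℂ) ::ₘ entries fun j => f j + (m j : ℂ)) (entries f) 1 1 * poch b q *
        poch (-(i : ℂ)) q
    linear_combination -(K * (poch (c - b - (M : ℂ)) M)⁻¹) * h1 +
      K * poch (c - b) (i - q) * inv_mul_cancel₀ hcb

/-- Expanding `(f+k)_m` in `(-k)_q` makes each inner sum a shifted Chu-Vandermonde sum. This gives
the Newton coefficients that `poch_div_mul_shiftPoch` needs. -/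
lemma sum_poch_neg_mul_shiftPoch (hf : ∀ (j : Fin r) (k : ℕ), f j ≠ -(k : ℂ)) (b c : ℂ)
    (hcb : poch (c - b - ((∑ j, m j : ℕ) : ℂ)) (∑ j, m j) ≠ 0) (i : ℕ) (hc : poch c i ≠ 0) :
    ∑ k ∈ Finset.range (i + 1), poch (-(i : ℂ)) k / (k.factorial : ℂ) *
        (poch b k / poch c k * ((shiftPoch f m).eval (k : ℂ) / pochMulti f m)) =
      poch (c - b - ((∑ j, m j : ℕ) : ℂ)) i / poch c i *
        (millerParisQ b c f m).eval (-(i : ℂ)) := by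
  rw [div_mul_eq_mul_div, poch_mul_eval_millerParisQ f m b c hcb, Finset.sum_div]
  simp only [eval_shiftPoch_div_eq_sum f m hf, Finset.mul_sum]
  rw [Finset.sum_comm]
  apply Finset.sum_congr rfl
  intro q _
  set g := hypF (-(q : ℂ) ::ₘ entries fun j => f j + (m j : ℂ)) (entries f) 1 1
  rcases lt_or_ge i q with hiq | hqi
  · rw [poch_neg_natCast_eq_zero hiq, Finset.sum_eq_zero]
    · simp
    · intro k hk
      rw [poch_neg_natCast_eq_zero ((Nat.lt_succ_iff.mp (Finset.mem_range.mp hk)).trans_lt hiq)]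
      simp
  · have h := sum_poch_neg_mul_poch_div i q hqi b c hc
    calc _ = g / (q.factorial : ℂ) * ∑ k ∈ Finset.range (i + 1),
          poch (-(i : ℂ)) k / (k.factorial : ℂ) * (poch b k / poch c k) * poch (-(k : ℂ)) q := by
          rw [Finset.mul_sum]
          exact Finset.sum_congr rfl fun k _ => by ring
      _ = _ := by rw [h]; ring

lemma poch_div_mul_shiftPoch (hf : ∀ (j : Fin r) (k : ℕ), f j ≠ -(k : ℂ)) (b c : ℂ)
    (hcb : poch (c - b - ((∑ j, m j : ℕ) : ℂ)) (∑ j, m j) ≠ 0) {k n : ℕ} (hk : k ≤ n)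
    (hc : poch c n ≠ 0) :
    poch b k / poch c k * ((shiftPoch f m).eval (k : ℂ) / pochMulti f m) =
      ∑ i ∈ Finset.range (n + 1), poch (-(k : ℂ)) i / (i.factorial : ℂ) *
        (poch (c - b - ((∑ j, m j : ℕ) : ℂ)) i / poch c i *
          (millerParisQ b c f m).eval (-(i : ℂ))) := by
  rw [sum_newton (fun k =>
    poch b k / poch c k * ((shiftPoch f m).eval (k : ℂ) / pochMulti f m)) hk]
  apply Finset.sum_congr rfl
  intro i hi
  rw [sum_poch_neg_mul_shiftPoch f m hf b c hcb i
    (poch_ne_zero_of_le hc (Nat.lt_succ_iff.mp (Finset.mem_range.mp hi)))]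

end MillerParis

/-- Each root contributes `(ζ+k)/ζ`, and the product of these is `Q(-k)/Q(0)`. -/
lemma pochVec_roots_div (Q : ℂ[X]) (hQ : Q.eval 0 = 1) (k : ℕ)
    (hk : ∀ ζ ∈ Q.roots, poch ζ k ≠ 0) :
    pochVec (Q.roots.map fun ζ => ζ + 1) k / pochVec Q.roots k = Q.eval (-(k : ℂ)) := by
  have hne : pochVec Q.roots k ≠ 0 := by
    rw [pochVec, Ne, Multiset.prod_eq_zero_iff, Multiset.mem_map]
    rintro ⟨ζ, hζ, h0⟩
    exact hk ζ hζ h0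
  have heval : ∀ x, Q.eval x = Q.leadingCoeff * (Q.roots.map fun ζ => x - ζ).prod := fun x =>
    (IsAlgClosed.splits Q).eval_eq_prod_roots x
  have hmul : pochVec (Q.roots.map fun ζ => ζ + 1) k * (Q.roots.map fun ζ => 0 - ζ).prod =
      pochVec Q.roots k * (Q.roots.map fun ζ => -(k : ℂ) - ζ).prod := by
    rw [pochVec, pochVec, Multiset.map_map, ← Multiset.prod_map_mul, ← Multiset.prod_map_mul]
    refine congrArg _ (Multiset.map_congr rfl fun ζ _ => ?_)
    have h1 := poch_succ ζ k
    rw [poch_succ_left] at h1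
    simp only [Function.comp_apply]
    linear_combination -h1
  have hQ0 := heval 0
  rw [hQ] at hQ0
  rw [div_eq_iff hne, heval]
  linear_combination Q.leadingCoeff * hmul +
    pochVec (Q.roots.map fun ζ => ζ + 1) k * hQ0

/-! ### The polynomial `Y_p` -/

section PolyY

variable {l : ℕ} (h : Fin l → ℂ) (p : Fin l → ℕ)

lemma eval_polyY (d e lam t : ℂ) :
    (polyY d e lam h p 1 1).eval t = pochMulti (fun j => h j - d) p / Complex.Gamma (e - d) *
      ∑ j ∈ Finset.range ((∑ i, p i) + 1), poch (d - e + 1) j / (j.factorial : ℂ) *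
          hypF (-(j : ℂ) ::ₘ entries fun i => 1 - h i + d)
            (entries fun i => 1 - h i + d - (p i : ℂ)) 1 1 * poch (t + d) j *
          poch (t + (d - e - lam + (j : ℂ) + 1)) ((∑ i, p i) - j) := by
  simp [polyY, eval_finsetSum, poch]

lemma eval_shiftPoch_eq_sum (d : ℂ)
    (hY : ∀ i, poch (1 - h i + d - (p i : ℂ)) (∑ i, p i) ≠ 0) (t : ℂ) :
    (shiftPoch h p).eval t = ∑ j ∈ Finset.range ((∑ i, p i) + 1),
      poch (t + d) j / (j.factorial : ℂ) * (pochMulti (fun j => h j - d) p *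
        hypF (-(j : ℂ) ::ₘ entries fun i => 1 - h i + d)
            (entries fun i => 1 - h i + d - (p i : ℂ)) 1 1) := by
  -- Newton's formula is used in the variable `t + d`, so that the basis `(t+d)_j` can later merge
  -- with `(d)_k`.
  have h0 : (shiftPoch h p).eval t = (shiftPoch (fun j => h j - d) p).eval (t + d) := by
    rw [eval_shiftPoch, eval_shiftPoch]
    exact Finset.prod_congr rfl fun j _ => by congr 1; ring
  rw [h0, eval_eq_sum_newton _ (natDegree_shiftPoch_le _ _)]
  apply Finset.sum_congr rfl
  intro j hj
  congr 1
  rw [hypF_neg_natCast_cons, Finset.mul_sum]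
  apply Finset.sum_congr rfl
  intro s hs
  have hsp : s ≤ ∑ i, p i := by
    simp only [Finset.mem_range] at hj hs
    lia
  have hy : ∀ i, 1 - h i + d = 1 - (h i - d) := fun i => by ring
  simp only [hy] at hY ⊢
  rw [← pochMulti_mul_pochVec_div (fun j => h j - d) p s
    fun i => poch_ne_zero_of_le (hY i) hsp, eval_one]
  ring

/-- Both sides equal `(-1)^j (u-j)_{n+j}`. With `u = e - d` this moves the `i`-dependence of the
Chu-Vandermonde value into a denominator. -/
lemma poch_sub_mul_poch_reflect (u : ℂ) {n i : ℕ} (hi : i ≤ n) (j : ℕ) :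
    (-1) ^ i * poch (u - j) (n - i) * poch (1 - u - n) (i + j) = poch u n * poch (1 - u) j := by
  have h1 := poch_reflect (u - j + (n - i : ℕ)) (i + j)
  have h2 := poch_reflect (u - j) j
  have h3 := poch_add (u - j) (n - i) (i + j)
  have h4 := poch_add (u - j) j n
  rw [show n - i + (i + j) = j + n by lia, h4, sub_add_cancel] at h3
  rw [show 1 - (u - j + (n - i : ℕ)) - ((i + j : ℕ) : ℂ) = 1 - u - n by
    push_cast [Nat.cast_sub hi]; ring] at h1
  rw [show 1 - (u - j) - j = 1 - u by ring] at h2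
  rw [h1, h2, pow_add]
  have : ((-1) ^ i * (-1) ^ i : ℂ) = 1 := by rw [← mul_pow]; simp
  linear_combination -((-1) ^ j) * h3 + (-1) ^ j * poch (u - j) (n - i) *
    poch (u - j + (n - i : ℕ)) (i + j) * this

/-- Since `(d)_k (d+k)_j = (d)_j (d+j)_k`, each `j`-term of the expansion of `(h+k)_p` is summed by
the shifted Chu-Vandermonde formula. -/
lemma sum_poch_neg_mul_shiftPoch_eq_polyY (d e : ℂ) {n i : ℕ} (hi : i ≤ n)
    (he : poch e n ≠ 0) (hed : ∀ k : ℕ, e - d ≠ -(k : ℂ))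
    (hpre : poch (1 + d - e - (n : ℂ)) (∑ i, p i) ≠ 0)
    (hlow : poch (1 + d - e - (n : ℂ) + ((∑ i, p i : ℕ) : ℂ)) n ≠ 0)
    (hY : ∀ i, poch (1 - h i + d - (p i : ℂ)) (∑ i, p i) ≠ 0) :
    ∑ k ∈ Finset.range (n + 1), poch (-(n : ℂ)) k / (k.factorial : ℂ) *
        (poch d k / poch e k) * poch (-(k : ℂ)) i * (shiftPoch h p).eval (k : ℂ) =
      poch (e - d) n * Complex.Gamma (e - d) / (poch e n * poch (1 + d - e - (n : ℂ)) (∑ i, p i)) *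
        (poch (-(n : ℂ)) i * poch d i /
          poch (1 + d - e - (n : ℂ) + ((∑ i, p i : ℕ) : ℂ)) i *
          (polyY d e n h p 1 1).eval (i : ℂ)) := by
  have hG : Complex.Gamma (e - d) ≠ 0 := Complex.Gamma_ne_zero hed
  have hlow' := poch_ne_zero_of_le hlow hi
  rw [eval_polyY]
  simp only [eval_shiftPoch_eq_sum h p d hY, Finset.mul_sum]
  rw [Finset.sum_comm]
  apply Finset.sum_congr rfl
  intro j hj
  have hjp : j ≤ ∑ i, p i := Nat.lt_succ_iff.mp (Finset.mem_range.mp hj)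
  set M := ∑ i, p i
  set g := hypF (-(j : ℂ) ::ₘ entries fun i => 1 - h i + d)
            (entries fun i => 1 - h i + d - (p i : ℂ)) 1 1
  set H := pochMulti (fun j => h j - d) p
  set w := 1 + d - e - (n : ℂ) with hw
  have hs := sum_poch_neg_mul_poch_div n i hi (d + j) e he
  have key := poch_sub_mul_poch_reflect (e - d) hi j
  have hw1 : 1 - (e - d) - (n : ℂ) = w := by rw [hw]; ring
  have hd1 : 1 - (e - d) = d - e + 1 := by ring
  rw [hw1, hd1] at key
  have h1 := poch_add w M i
  -- Extends the denominator `(w)_{i+j}` to `(w)_{M+i}`, which does not depend on `j`; the extra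
  -- factor is the last one in `Y_p`.
  have h2 := poch_add w (i + j) (M - j)
  rw [show i + j + (M - j) = M + i by lia, h1] at h2
  have hw2 : (i : ℂ) + (d - e - n + j + 1) = w + ((i + j : ℕ) : ℂ) := by
    rw [hw]; push_cast; ring
  have h3 := poch_comm d j i
  rw [add_comm d (i : ℂ)] at h3
  have hsub : e - (d + j) = e - d - j := by ring
  rw [hsub] at hs
  rw [hw2]
  calc _ = H * g / (j.factorial : ℂ) * poch d j * ∑ k ∈ Finset.range (n + 1),
        poch (-(n : ℂ)) k / (k.factorial : ℂ) * (poch (d + j) k / poch e k) *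
          poch (-(k : ℂ)) i := by
        rw [Finset.mul_sum]
        refine Finset.sum_congr rfl fun k _ => ?_
        have h4 := poch_comm d j k
        rw [add_comm d (k : ℂ)] at h4
        linear_combination -(H * g / (j.factorial : ℂ) * (poch (-(n : ℂ)) k / (k.factorial : ℂ)) *
          poch (-(k : ℂ)) i / poch e k) * h4
    _ = H * g / (j.factorial : ℂ) * poch (-(n : ℂ)) i * (poch d i * poch (i + d) j) / poch e n *
          ((-1) ^ i * poch (e - d - j) (n - i)) := by
        rw [hs, ← h3]; ring
    _ = H * g / (j.factorial : ℂ) * poch (-(n : ℂ)) i * (poch d i * poch (i + d) j) / poch e n *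
          (poch (e - d) n * poch (d - e + 1) j * poch (w + ((i + j : ℕ) : ℂ)) (M - j) /
            (poch w M * poch (w + M) i)) := by
        congr 1
        rw [eq_div_iff (mul_ne_zero hpre hlow'), h2, ← key]
        ring
    _ = _ := by field_simp

end PolyY

/-! ### The transformation -/

theorem theorem4 {r l : ℕ} (m : Fin r → ℕ) (p : Fin l → ℕ) (f : Fin r → ℂ) (h : Fin l → ℂ)
    (b c d e : ℂ) (n : ℕ)
    -- the hypotheses of the theorem
    (hbf : ∀ j, b ≠ f j)
    (hcb : poch (c - b - ((∑ j, m j : ℕ) : ℂ)) (∑ j, m j) ≠ 0)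
    -- no lower parameter on the left is a non-positive integer
    (hc : ∀ k : ℕ, c ≠ -(k : ℂ)) (he : ∀ k : ℕ, e ≠ -(k : ℂ))
    (hf : ∀ (j : Fin r) (k : ℕ), f j ≠ -(k : ℂ)) (hh : ∀ (i : Fin l) (k : ℕ), h i ≠ -(k : ℂ))
    -- `Γ(e - d)` is finite, and no denominator on the right (in the factor, in the terms of the
    -- terminating series, in the polynomial `Y_p`) vanishes
    (hed : ∀ k : ℕ, e - d ≠ -(k : ℂ))
    (hpre : poch (1 + d - e - (n : ℂ)) (∑ i, p i) ≠ 0)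
    (hlow : poch (1 + d - e - (n : ℂ) + ((∑ i, p i : ℕ) : ℂ)) n ≠ 0)
    (hζ : ∀ ζ ∈ (millerParisQ b c f m).roots, poch ζ n ≠ 0)
    (hY : ∀ i, poch (1 - h i + d - (p i : ℂ)) (∑ i, p i) ≠ 0) :
    hypF (({-(n : ℂ), b, d} : Multiset ℂ) + entries (fun j => f j + (m j : ℂ))
          + entries (fun i => h i + (p i : ℂ)))
        (({c, e} : Multiset ℂ) + entries f + entries h) 1 1 =
      poch (e - d) n * Complex.Gamma (e - d) /
          (poch e n * poch (1 + d - e - (n : ℂ)) (∑ i, p i) * pochMulti h p) *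
        hypF (({-(n : ℂ), c - b - ((∑ j, m j : ℕ) : ℂ), d} : Multiset ℂ)
              + (millerParisQ b c f m).roots.map (fun ζ => ζ + 1))
            (({c, 1 + d - e - (n : ℂ) + ((∑ i, p i : ℕ) : ℂ)} : Multiset ℂ)
              + (millerParisQ b c f m).roots)
            (polyY d e (n : ℂ) h p 1 1) 1 := by
  have hc' : poch c n ≠ 0 := poch_ne_zero hc n
  have he' : poch e n ≠ 0 := poch_ne_zero he n
  set M := ∑ j, m j with hM
  set N := ∑ i, p i with hN
  set Q := millerParisQ b c f m with hQ
  set Y := polyY d e (n : ℂ) h p 1 1 with hYdef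
  set w := 1 + d - e - (n : ℂ) with hw
  have hupper : ∀ (x y : ℂ) (A : Multiset ℂ), ({-(n : ℂ), x, y} : Multiset ℂ) + A =
      -(n : ℂ) ::ₘ (({x, y} : Multiset ℂ) + A) := fun x y A => by
    rw [Multiset.insert_eq_cons, Multiset.cons_add]
  have hroots : ∀ i ∈ Finset.range (n + 1),
      pochVec (Q.roots.map fun ζ => ζ + 1) i / pochVec Q.roots i = Q.eval (-(i : ℂ)) :=
    fun i hi => pochVec_roots_div Q (eval_zero_millerParisQ f m b c hcb) i fun ζ hz =>
      poch_ne_zero_of_le (hζ ζ hz) (Nat.lt_succ_iff.mp (Finset.mem_range.mp hi))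
  rw [add_assoc, hupper, hupper, hypF_neg_natCast_cons, hypF_neg_natCast_cons]
  -- The `i`-range reaches `n` for every `k`, so the two sums can be interchanged freely.
  calc _ = ∑ k ∈ Finset.range (n + 1), ∑ i ∈ Finset.range (n + 1),
        (poch (c - b - (M : ℂ)) i / poch c i * Q.eval (-(i : ℂ)) /
          ((i.factorial : ℂ) * pochMulti h p)) *
        (poch (-(n : ℂ)) k / (k.factorial : ℂ) * (poch d k / poch e k) * poch (-(k : ℂ)) i *
          (shiftPoch h p).eval (k : ℂ)) := by
        refine Finset.sum_congr rfl fun k hk => ?_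
        have h1 := poch_div_mul_shiftPoch f m hf b c hcb
          (Nat.lt_succ_iff.mp (Finset.mem_range.mp hk)) hc'
        have h2 := pochVec_div_pochVec f m hf k
        have h3 := pochVec_div_pochVec h p hh k
        rw [← h2] at h1
        simp only [pochVec_add, pochVec_pair, eval_one, mul_one]
        calc _ = poch (-(n : ℂ)) k / (k.factorial : ℂ) * (poch d k / poch e k) *
              (pochVec (entries fun i => h i + (p i : ℂ)) k / pochVec (entries h) k) *
              (poch b k / poch c k * (pochVec (entries fun j => f j + (m j : ℂ)) k /
                pochVec (entries f) k)) := by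
              simp only [div_eq_mul_inv, mul_inv]
              ring
          _ = _ := by
              rw [h1, h3, Finset.mul_sum]
              refine Finset.sum_congr rfl fun i _ => ?_
              simp only [div_eq_mul_inv, mul_inv]
              ring
    _ = _ := by
        rw [Finset.sum_comm, Finset.mul_sum]
        refine Finset.sum_congr rfl fun i hi => ?_
        rw [← Finset.mul_sum, sum_poch_neg_mul_shiftPoch_eq_polyY h p d e
          (Nat.lt_succ_iff.mp (Finset.mem_range.mp hi)) he' hed hpre hlow hY]
        simp only [pochVec_add, pochVec_pair]
        rw [mul_div_mul_comm _ (pochVec (Q.roots.map _) i), hroots i hi]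
        simp only [div_eq_mul_inv, mul_inv]
        ring
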